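/- Let $\mathcal M=(S,A,T,R,\beta)$ be a Markov decision process with finite state space $S$, finite non-empty sets $A(s)$ of available actions, transition probabilities $T(s'\mid s,a)$, rewards $R(s,a,s')\in\mathbb R$ and initial distribution $\beta$, together with finitely many steady-state specifications $(L_i,[l_i,u_i])$, $L_i\subseteq S$. Write $R(s,a)=\sum_{s'}T(s'\mid s,a)R(s,a,s')$. The transition graph of $\mathcal M$ has an edge $s\to s'$ iff $T(s'\mid s,a)>0$ for some $a\in A(s)$. A terminal strongly connected component (TSCC) is a strongly connected component of the transition graph that is reachable from some state $s_0$ with $\beta_{s_0}>0$ and has no outgoing edges; $r_1(\mathcal M),\dots,r_m(\mathcal M)$ are the TSCCs of $\mathcal M$, $r(\mathcal M)$ is their union and $\bar r(\mathcal M)=S\setminus r(\mathcal M)$. A stationary policy $\pi$ assigns to each $s$ a probability distribution $\pi(\cdot\mid s)$ on $A(s)$; it induces the Markov chain $\mathcal M_\pi$ with transition probabilities $T_\pi(s'\mid s)=\sum_{a\in A(s)}T(s'\mid s,a)\pi(a\mid s)$ and initial distribution $\beta$, whose TSCCs and their union $r(\mathcal M_\pi)$ are defined in the same way. Let $\Pi_{CPU}$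 be the set of stationary policies $\pi$ such that $r(\mathcal M_\pi)\subseteq r(\mathcal M)$ and, for every $k$, exactly one TSCC of $\mathcal M_\pi$ is contained in $r_k(\mathcal M)$. The steady-state distribution of $\pi$ is $$\mathrm{Pr}^\infty_\pi(s,a)=\lim_{n\to\infty}\frac1n\sum_{t=1}^n \Pr(S_t=s,A_t=a\mid\beta,\pi),\qquad s\in S,\ a\in A(s);$$ $\pi$ meets the specifications if this limit exists for all $s\in S$, $a\in A(s)$ and $l_i\le\sum_{s\in L_i}\sum_{a\in A(s)}\mathrm{Pr}^\infty_\pi(s,a)\le u_i$ for all $i$. The expected average reward of $\pi$ is $R^\infty_\pi(\beta)=\liminf_{n\to\infty}\frac1n\sum_{t=1}^n\mathbb E[R(S_t,A_t)]$, where $S_0\sim\beta$ and actions are chosen by $\pi$. Let $Q_0$ be the set of $(x,y)=(x_{sa},y_{sa})_{s\in S,a\in A(s)}$ with $x_{sa}\in[0,1]$, $y_{sa}\ge 0$, $$\sum_{s}\sum_{a\in A(s)}x_{sa}T(s'\mid s,a)=\sum_{a\in A(s')}x_{s'a}\quad\forall s'\in S,$$ $$\sum_{s}\sum_{a\in A(s)}y_{sa}T(s'\mid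 s,a)=\sum_{a\in A(s')}(x_{s'a}+y_{s'a})-\beta_{s'}\quad\forall s'\in S,$$ $$\sum_{f\in\bar r(\mathcal M)}\sum_{a\in A(f)}x_{fa}=0 .$$ Let $\mathrm{LP}_3$ be the problem of maximizing $\sum_{s}\sum_{a\in A(s)}x_{sa}R(s,a)$ over all $(x,y)\in Q_0$ with $l_i\le\sum_{s\in L_i}\sum_{a\in A(s)}x_{sa}\le u_i$ for all $i$. Put $x_s=\sum_{a\in A(s)}x_{sa}$ and $y_s=\sum_{a\in A(s)}y_{sa}$. **Theorem.** Let $(x,y)$ be an optimal solution of $\mathrm{LP}_3$. Suppose that for every TSCC $r_k(\mathcal M)$ the digraph with vertex set $V_k^+(x)=\{s\in r_k(\mathcal M):x_s>0\}$, and with an edge $s\to s'$ whenever $x_{sa}T(s'\mid s,a)>0$ for some $a\in A(s)$, is strongly connected (in particular $V_k^+(x)\neq\emptyset$). Let $\pi=\pi(x,y)$ be any stationary policy with $\pi(a\mid s)=x_{sa}/x_s$ if $x_s>0$, $\pi(a\mid s)=y_{sa}/y_s$ if $x_s=0<y_s$, and $\pi(\cdot\mid s)$ arbitrary if $x_s=y_s=0$.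 Then $\pi\in\Pi_{CPU}$, $\pi$ meets the specifications, and $R^\infty_{\pi'}(\beta)\le R^\infty_\pi(\beta)$ for every $\pi'\in\Pi_{CPU}$ that meets the specifications. -/

import Mathlib

open scoped BigOperators
open Filter Topology

noncomputable section

/-- A Markov decision process `(S, A, T, R, β)` with finite state space `S`.
`act s` is the (finite, non-empty) set `A(s)` of actions available in state `s`,
`T s a s'` is `T(s' | s, a)`, and `R s a s'` is the reward of the transition. Values of `T` and `R`
at actions outside `A(s)` are never used. -/
structure MDP (S A : Type*) [Fintype S] where
  act : S → Finset A
  act_nonempty : ∀ s, (act s).Nonempty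
  T : S → A → S → ℝ
  T_nonneg : ∀ s, ∀ a ∈ act s, ∀ s', 0 ≤ T s a s'
  T_sum : ∀ s, ∀ a ∈ act s, ∑ s', T s a s' = 1
  R : S → A → S → ℝ
  β : S → ℝ
  β_nonneg : ∀ s, 0 ≤ β s
  β_sum : ∑ s, β s = 1

/-- A labeled MDP: an MDP with finitely many labels `L i ⊆ S` and
steady-state specifications `(L i, [l i, u i])`. -/
structure LMDP (S A : Type*) [Fintype S] extends MDP S A where
  nL : ℕ
  L : Fin nL → Finset S
  l : Fin nL → ℝ
  u : Fin nL → ℝ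

/-- `C` is a strongly connected component of the digraph with edge relation `E`: a maximal set of
vertices any two of which are joined by directed (possibly empty) paths in both directions. -/
def IsSCC {S : Type*} (E : S → S → Prop) (C : Set S) : Prop :=
  Maximal (fun D : Set S => ∀ s ∈ D, ∀ s' ∈ D, Relation.ReflTransGen E s s') C

/-- `C` is a terminal strongly connected component of the digraph `E` with initial distribution
`β`: an SCC that can be reached from some state `s₀` with `β s₀ > 0` and that has no outgoing
edges. -/
def IsTSCC {S : Type*} (E : S → S → Prop) (β : S → ℝ) (C : Set S) : Prop :=
  IsSCC E C ∧
  (∃ s₀, 0 < β s₀ ∧ ∃ s ∈ C, Relation.ReflTransGen E s₀ s) ∧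
  (∀ s ∈ C, ∀ s', E s s' → s' ∈ C)

/-- The digraph with vertex set `V` and the edges of `E` between vertices of `V` is strongly
connected (in particular it has a vertex). -/
def StronglyConnectedOn {S : Type*} (E : S → S → Prop) (V : Set S) : Prop :=
  V.Nonempty ∧
  ∀ s ∈ V, ∀ s' ∈ V, Relation.ReflTransGen (fun v w => v ∈ V ∧ w ∈ V ∧ E v w) s s'

namespace MDP

variable {S A : Type*} [Fintype S] (M : MDP S A)

/-- Edges of the transition graph of the MDP. -/
def edge (s s' : S) : Prop := ∃ a ∈ M.act s, 0 < M.T s a s'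

/-- `C` is one of the TSCCs `r_k(M)` of the MDP. -/
def IsTSCCOf (C : Set S) : Prop := IsTSCC M.edge M.β C

/-- The union `r(M)` of all TSCCs of the MDP. -/
def recSet : Set S := {s | ∃ C, M.IsTSCCOf C ∧ s ∈ C}

/-- Stationary policies: `π s a` is `π(a | s)`, a probability distribution on `A(s)`. -/
def IsPolicy (π : S → A → ℝ) : Prop :=
  ∀ s, (∀ a, 0 ≤ π s a) ∧ (∀ a, a ∉ M.act s → π s a = 0) ∧ ∑ a ∈ M.act s, π s a = 1

/-- Transition probabilities `T_π(s' | s)` of the Markov chain `M_π` induced by `π`. -/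
def chainT (π : S → A → ℝ) (s s' : S) : ℝ := ∑ a ∈ M.act s, M.T s a s' * π s a

/-- Edges of the transition graph of `M_π`. -/
def chainEdge (π : S → A → ℝ) (s s' : S) : Prop := 0 < M.chainT π s s'

/-- `C` is one of the TSCCs of the Markov chain `M_π`. -/
def IsTSCCOfChain (π : S → A → ℝ) (C : Set S) : Prop := IsTSCC (M.chainEdge π) M.β C

/-- The union `r(M_π)` of all TSCCs of `M_π`. -/
def chainRecSet (π : S → A → ℝ) : Set S := {s | ∃ C, M.IsTSCCOfChain π C ∧ s ∈ C}

/-- The set `Π_CPU` of class-preserving-up-to-unichain policies: stationary policies with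
`r(M_π) ⊆ r(M)` for which every TSCC of `M` contains exactly one TSCC of `M_π`. -/
def CPU : Set (S → A → ℝ) :=
  {π | M.IsPolicy π ∧ M.chainRecSet π ⊆ M.recSet ∧
    ∀ C, M.IsTSCCOf C → ∃! D : Set S, M.IsTSCCOfChain π D ∧ D ⊆ C}

/-- `Pr(S_t = s | β, π)`, where `S_0` has law `β`. -/
def stateProb (π : S → A → ℝ) : ℕ → S → ℝ
  | 0 => M.β
  | t + 1 => fun s' => ∑ s, stateProb π t s * M.chainT π s s'

/-- `Pr(S_t = s, A_t = a | β, π)`. -/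
def stateActProb (π : S → A → ℝ) (t : ℕ) (s : S) (a : A) : ℝ := M.stateProb π t s * π s a

/-- `p` is the steady-state distribution `Pr^∞_π` (occupation measure) of `π`: the Cesàro limit of
the state-action probabilities exists and equals `p s a` for all `s` and `a ∈ A(s)`. -/
def IsSteadyState (π p : S → A → ℝ) : Prop :=
  ∀ s, ∀ a ∈ M.act s,
    Tendsto (fun n : ℕ => (1 / (n : ℝ)) * ∑ t ∈ Finset.Icc 1 n, M.stateActProb π t s a)
      atTop (𝓝 (p s a))

/-- `R(s, a) = ∑_{s'} T(s' | s, a) R(s, a, s')`. -/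
def meanR (s : S) (a : A) : ℝ := ∑ s', M.T s a s' * M.R s a s'

/-- Expected average reward `R^∞_π(β) = liminf_n (1/n) ∑_{t=1}^n E[R(S_t, A_t)]`. -/
def avgReward (π : S → A → ℝ) : ℝ :=
  liminf (fun n : ℕ => (1 / (n : ℝ)) * ∑ t ∈ Finset.Icc 1 n,
    ∑ s, ∑ a ∈ M.act s, M.stateActProb π t s a * M.meanR s a) atTop

/-- The total `z_s = ∑_{a ∈ A(s)} z_{sa}`. -/
def tot (z : S → A → ℝ) (s : S) : ℝ := ∑ a ∈ M.act s, z s a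

/-- The polyhedron `Q_0`. -/
structure InQ0 (x y : S → A → ℝ) : Prop where
  balance : ∀ s', ∑ s, ∑ a ∈ M.act s, x s a * M.T s a s' = ∑ a ∈ M.act s', x s' a
  flow : ∀ s', ∑ s, ∑ a ∈ M.act s, y s a * M.T s a s' =
    ∑ a ∈ M.act s', (x s' a + y s' a) - M.β s'
  trans : ∑ᶠ f ∈ M.recSetᶜ, ∑ a ∈ M.act f, x f a = 0
  x_mem : ∀ s, ∀ a ∈ M.act s, x s a ∈ Set.Icc (0 : ℝ) 1
  y_nonneg : ∀ s, ∀ a ∈ M.act s, 0 ≤ y s a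

/-- The linear objective `∑_s ∑_{a ∈ A(s)} x_{sa} ∑_{s'} T(s' | s, a) R(s, a, s')`. -/
def objective (x : S → A → ℝ) : ℝ := ∑ s, ∑ a ∈ M.act s, x s a * M.meanR s a

/-- `π` is a stationary policy of the form `π(x, y)`: it equals `x_{sa} / x_s` where `x_s > 0`,
`y_{sa} / y_s` where `x_s = 0` and `y_s > 0`, and is arbitrary elsewhere. -/
def IsPolicyFrom (x y π : S → A → ℝ) : Prop :=
  M.IsPolicy π ∧
  (∀ s, 0 < M.tot x s → ∀ a ∈ M.act s, π s a = x s a / M.tot x s) ∧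
  (∀ s, ¬ 0 < M.tot x s → 0 < M.tot y s → ∀ a ∈ M.act s, π s a = y s a / M.tot y s)

/-- Edges of the support digraph of `x`: the transitions possible under actions with
`x_{sa} > 0`. -/
def supportEdge (x : S → A → ℝ) (s s' : S) : Prop :=
  ∃ a ∈ M.act s, 0 < x s a ∧ 0 < M.T s a s'

/-- The vertices `{s ∈ C : x_s > 0}` of the support digraph of `x` inside `C`. -/
def supportVerts (x : S → A → ℝ) (C : Set S) : Set S := {s | s ∈ C ∧ 0 < M.tot x s}

end MDP

namespace LMDP

variable {S A : Type*} [Fintype S] (M : LMDP S A)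

/-- The specification constraints on a vector `x` of state-action values. -/
def SpecConstraints (x : S → A → ℝ) : Prop :=
  ∀ i, M.l i ≤ ∑ s ∈ M.L i, ∑ a ∈ M.act s, x s a ∧
    ∑ s ∈ M.L i, ∑ a ∈ M.act s, x s a ≤ M.u i

/-- Feasible points of `LP_3`. -/
def FeasibleLP3 (x y : S → A → ℝ) : Prop := M.InQ0 x y ∧ M.SpecConstraints x

/-- Optimal solutions of `LP_3`. -/
def OptimalLP3 (x y : S → A → ℝ) : Prop :=
  M.FeasibleLP3 x y ∧ ∀ x' y', M.FeasibleLP3 x' y' → M.objective x' ≤ M.objective x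

/-- `π` meets the specifications: its steady-state distribution exists and satisfies the
steady-state constraints. -/
def MeetsSpecs (π : S → A → ℝ) : Prop :=
  ∃ p, M.IsSteadyState π p ∧ M.SpecConstraints p

end LMDP

end

/-! The theorem matches steady-state distributions with points of `Q₀`, in two directions.

Upper bound. For a policy with `r(M_π) ⊆ r(M)` and kernel `P`, the iterates of `P` are bounded, so
the row-vector space is the direct sum of the kernel and the range of `1 - P`. Hence `β = k + (w -
wP)` with `kP = k`, and the Cesàro means of `β Pᵗ` telescope to `k`. Correcting `w` by stationary
vectors makes it a nonnegative `y`, so `(k_s π(a|s), y_s π(a|s))` lies in `Q₀`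
(`IsPolicy.exists_steadyState`). The average reward is then the objective at an LP point, feasible
when the policy meets the specifications.

Attainment. It remains to see that the steady state of `π(x, y)` is `x` itself
(`IsPolicyFrom.isSteadyState`). The vector `x_s` is stationary for `M_π`, so each support `V_C⁺(x)`
is closed, and it is strongly connected by hypothesis. Balancing the flow `y` across cuts shows that
these supports are exactly the TSCCs of `M_π`, which gives `π ∈ Π_CPU`. The Cesàro limit `k` lives
on the same supports, and on each of them a stationary vector is determined by its mass
(`stationary_unique`).

The masses agree by `InQ0.mass_eq`: the mass of a TSCC `C` of `M` is `β(C)` plus the `y`-flow into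
`C`. That flow comes from outside `r(M)`, where `x` vanishes and both `y`-vectors follow `π`. Their
difference there is invariant, so it leaks nothing into `r(M)` (`no_outflow`). -/

/-! ### Row vectors under a stochastic kernel -/

/-- `P` is a stochastic matrix. -/
structure IsStochastic {S : Type*} [Fintype S] (P : S → S → ℝ) : Prop where
  nonneg : ∀ s s', 0 ≤ P s s'
  sum_one : ∀ s, ∑ s', P s s' = 1

/-- The action `v ↦ v P` of a matrix on row vectors. -/
def rowMap {S : Type*} [Fintype S] (P : S → S → ℝ) : (S → ℝ) →ₗ[ℝ] (S → ℝ) where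
  toFun v s' := ∑ s, v s * P s s'
  map_add' v w := by
    ext s'
    simp [add_mul, Finset.sum_add_distrib]
  map_smul' c v := by
    ext s'
    simp [Finset.mul_sum, mul_assoc]

theorem rowMap_apply {S : Type*} [Fintype S] (P : S → S → ℝ) (v : S → ℝ) (s' : S) :
    rowMap P v s' = ∑ s, v s * P s s' := rfl

/-- Balance of a flow `q` across a cut: total flow into `D` in terms of total flow out of the
vertices of `D`. -/
theorem sum_flow_cut {S : Type*} [Fintype S] [DecidableEq S] (q : S → S → ℝ) (D : Finset S) :
    ∑ s' ∈ D, ∑ s, q s s' = ∑ s ∈ D, ∑ s', q s s' - ∑ s ∈ D, ∑ s' ∈ Dᶜ, q s s'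
      + ∑ s ∈ Dᶜ, ∑ s' ∈ D, q s s' := by
  have h1 : ∑ s' ∈ D, ∑ s, q s s' = ∑ s ∈ D, ∑ s' ∈ D, q s s' + ∑ s ∈ Dᶜ, ∑ s' ∈ D, q s s' := by
    rw [Finset.sum_comm, Finset.sum_add_sum_compl]
  have h2 : ∑ s ∈ D, ∑ s', q s s' = ∑ s ∈ D, ∑ s' ∈ D, q s s' + ∑ s ∈ D, ∑ s' ∈ Dᶜ, q s s' := by
    rw [← Finset.sum_add_distrib]
    exact Finset.sum_congr rfl fun s _ => (Finset.sum_add_sum_compl D _).symm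
  linarith

/-- A vanishing double sum of nonnegative terms has vanishing terms. -/
theorem eq_zero_of_sum_sum_nonpos {S : Type*} {q : S → S → ℝ} {D E : Finset S}
    (hq : ∀ s ∈ D, ∀ s' ∈ E, 0 ≤ q s s') (h : ∑ s ∈ D, ∑ s' ∈ E, q s s' ≤ 0)
    {s s' : S} (hs : s ∈ D) (hs' : s' ∈ E) : q s s' = 0 := by
  have h0 : ∑ s ∈ D, ∑ s' ∈ E, q s s' = 0 :=
    le_antisymm h (Finset.sum_nonneg fun s hs => Finset.sum_nonneg fun s' hs' => hq s hs s' hs')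
  have h1 := (Finset.sum_eq_zero_iff_of_nonneg
    (fun s hs => Finset.sum_nonneg fun s' hs' => hq s hs s' hs')).1 h0 s hs
  exact (Finset.sum_eq_zero_iff_of_nonneg (fun s' hs' => hq s hs s' hs')).1 h1 s' hs'

namespace IsStochastic

variable {S : Type*} [Fintype S] {P : S → S → ℝ}

theorem sum_rowMap (hP : IsStochastic P) (v : S → ℝ) : ∑ s, rowMap P v s = ∑ s, v s := by
  simp only [rowMap_apply]
  rw [Finset.sum_comm]
  simp [← Finset.mul_sum, hP.sum_one]

theorem rowMap_nonneg (hP : IsStochastic P) {v : S → ℝ} (hv : ∀ s, 0 ≤ v s) (s : S) :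
    0 ≤ rowMap P v s :=
  Finset.sum_nonneg fun s' _ => mul_nonneg (hv s') (hP.nonneg s' s)

theorem iterate_nonneg (hP : IsStochastic P) {v : S → ℝ} (hv : ∀ s, 0 ≤ v s) (n : ℕ) :
    ∀ s, 0 ≤ (rowMap P)^[n] v s := by
  induction n with
  | zero => exact hv
  | succ n ih =>
    rw [Function.iterate_succ_apply']
    exact hP.rowMap_nonneg ih

/-! ### Bounded iterates and Cesàro limits -/

theorem sum_abs_rowMap_le (hP : IsStochastic P) (v : S → ℝ) :
    ∑ s, |rowMap P v s| ≤ ∑ s, |v s| := by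
  calc ∑ s, |rowMap P v s| ≤ ∑ s, rowMap P (fun s => |v s|) s := by
        refine Finset.sum_le_sum fun s _ => (Finset.abs_sum_le_sum_abs _ _).trans ?_
        refine Finset.sum_le_sum fun s' _ => ?_
        rw [abs_mul, abs_of_nonneg (hP.nonneg s' s)]
    _ = _ := hP.sum_rowMap _

theorem abs_iterate_le (hP : IsStochastic P) (v : S → ℝ) (n : ℕ) (s : S) :
    |(rowMap P)^[n] v s| ≤ ∑ s, |v s| := by
  have h : ∑ s, |(rowMap P)^[n] v s| ≤ ∑ s, |v s| := by
    induction n with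
    | zero => simp
    | succ n ih =>
      rw [Function.iterate_succ_apply']
      exact (hP.sum_abs_rowMap_le _).trans ih
  exact (Finset.single_le_sum (f := fun s => |(rowMap P)^[n] v s|)
    (fun _ _ => abs_nonneg _) (Finset.mem_univ s)).trans h

theorem iterate_of_fixed {k : S → ℝ} (hk : rowMap P k = k) (n : ℕ) : (rowMap P)^[n] k = k :=
  Function.iterate_fixed hk n

/-- The coboundary part `w - wP` telescopes. -/
theorem sum_iterate {v k w : S → ℝ} (hk : rowMap P k = k)
    (hv : v = k + (w - rowMap P w)) (n : ℕ) :
    ∑ t ∈ Finset.range n, (rowMap P)^[t] v = (n : ℝ) • k + (w - (rowMap P)^[n] w) := by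
  induction n with
  | zero => simp
  | succ n ih =>
    have h : (rowMap P)^[n] v = k + ((rowMap P)^[n] w - (rowMap P)^[n + 1] w) := by
      rw [hv, ← Module.End.coe_pow, map_add, map_sub, Module.End.coe_pow, iterate_of_fixed hk,
        ← Function.iterate_succ_apply]
    rw [Finset.sum_range_succ, ih, h]
    push_cast
    module

theorem tendsto_inv_mul_iterate (hP : IsStochastic P) (w : S → ℝ) (s : S) :
    Tendsto (fun n : ℕ => (1 / (n : ℝ)) * (rowMap P)^[n] w s) atTop (𝓝 0) := by
  refine squeeze_zero_norm (a := fun n : ℕ => (∑ s, |w s|) / (n : ℝ)) (fun n => ?_)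
    (tendsto_const_div_atTop_nhds_zero_nat _)
  rw [Real.norm_eq_abs, abs_mul, abs_of_nonneg (by positivity : (0 : ℝ) ≤ 1 / (n : ℝ)),
    one_div_mul_eq_div]
  exact div_le_div_of_nonneg_right (hP.abs_iterate_le w n s) (Nat.cast_nonneg n)

theorem tendsto_cesaro (hP : IsStochastic P) {v k w : S → ℝ} (hk : rowMap P k = k)
    (hv : v = k + (w - rowMap P w)) (s : S) :
    Tendsto (fun n : ℕ => (1 / (n : ℝ)) * ∑ t ∈ Finset.range n, (rowMap P)^[t] v s)
      atTop (𝓝 (k s)) := by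
  have h1 : Tendsto (fun n : ℕ => k s + ((1 / (n : ℝ)) * w s
      - (1 / (n : ℝ)) * (rowMap P)^[n] w s)) atTop (𝓝 (k s + (0 * w s - 0))) :=
    tendsto_const_nhds.add ((tendsto_one_div_atTop_nhds_zero_nat.mul_const _).sub
      (hP.tendsto_inv_mul_iterate w s))
  simp only [zero_mul, sub_zero, add_zero] at h1
  refine h1.congr' ?_
  filter_upwards [eventually_gt_atTop 0] with n hn
  have hn' : (n : ℝ) ≠ 0 := by positivity
  have h := congrFun (sum_iterate hk hv n) s
  simp only [Finset.sum_apply, Pi.add_apply, Pi.smul_apply, Pi.sub_apply, smul_eq_mul] at h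
  rw [h]
  field_simp

/-- Mean ergodic decomposition: a vector in both the kernel and the range of `1 - P` has Cesàro
means tending both to itself and to `0`, so the two spaces are independent, and rank-nullity makes
them span. -/
theorem exists_decomposition (hP : IsStochastic P) (v : S → ℝ) :
    ∃ k w : S → ℝ, rowMap P k = k ∧ v = k + (w - rowMap P w) := by
  set g : (S → ℝ) →ₗ[ℝ] (S → ℝ) := LinearMap.id - rowMap P with hg
  have hdisj : Disjoint (LinearMap.ker g) (LinearMap.range g) := by
    rw [Submodule.disjoint_def]
    rintro k hk ⟨w, rfl⟩
    have hk' : rowMap P (g w) = g w := by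
      have h := LinearMap.mem_ker.1 hk
      rw [hg, LinearMap.sub_apply, LinearMap.id_apply, sub_eq_zero] at h
      exact h.symm
    ext s
    have h1 := hP.tendsto_cesaro (v := g w) (w := 0) hk' (by simp) s
    have h2 := hP.tendsto_cesaro (v := g w) (k := 0) (w := w) (map_zero _) (by simp [hg]) s
    exact tendsto_nhds_unique h1 h2
  have htop : LinearMap.ker g ⊔ LinearMap.range g = ⊤ :=
    Submodule.eq_top_of_disjoint _ _ (by
      rw [add_comm, LinearMap.finrank_range_add_finrank_ker]) hdisj
  obtain ⟨k, hk, z, ⟨w, rfl⟩, h⟩ := Submodule.mem_sup.1 (htop ▸ Submodule.mem_top (x := v))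
  refine ⟨k, w, ?_, h.symm⟩
  have h := LinearMap.mem_ker.1 hk
  rw [hg, LinearMap.sub_apply, LinearMap.id_apply, sub_eq_zero] at h
  exact h.symm

/-- For a nonnegative `v`, the Cesàro limit `k` of `v Pᵗ` exists and is stationary, and `v - k` is
the divergence of a nonnegative vector. -/
theorem exists_limit (hP : IsStochastic P) {v : S → ℝ} (hv : ∀ s, 0 ≤ v s) :
    ∃ k y : S → ℝ, rowMap P k = k ∧ (∀ s, 0 ≤ k s) ∧ (∀ s, 0 ≤ y s) ∧
      v - k = y - rowMap P y ∧ ∀ s, Tendsto (fun n : ℕ => (1 / (n : ℝ)) *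
        ∑ t ∈ Finset.Icc 1 n, (rowMap P)^[t] v s) atTop (𝓝 (k s)) := by
  obtain ⟨k, w, hk, hvk⟩ := hP.exists_decomposition v
  obtain ⟨k₂, w₂, hk₂, hwk⟩ := hP.exists_decomposition w
  have hlim : ∀ s, Tendsto (fun n : ℕ => (1 / (n : ℝ)) *
      ∑ t ∈ Finset.Icc 1 n, (rowMap P)^[t] v s) atTop (𝓝 (k s)) := by
    intro s
    -- The averages start at `t = 1`, so the decomposition is pushed forward to `vP`; its stationary
    -- part is still `k`.
    have hv' : rowMap P v = k + (rowMap P w - rowMap P (rowMap P w)) := by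
      conv_lhs => rw [hvk]
      rw [map_add, map_sub, hk]
    refine (hP.tendsto_cesaro hk hv' s).congr fun n => ?_
    have hI : Finset.Icc 1 n = Finset.Ico (0 + 1) (n + 1) := by
      ext
      simp only [Finset.mem_Icc, Finset.mem_Ico]
      omega
    rw [hI, Finset.range_eq_Ico, ← Finset.sum_Ico_add' (fun t => (rowMap P)^[t] v s) 0 n 1]
    rfl
  have hk0 : ∀ s, 0 ≤ k s := fun s => ge_of_tendsto' (hlim s) fun n =>
    mul_nonneg (by positivity) (Finset.sum_nonneg fun t _ => hP.iterate_nonneg hv t s)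
  have hy0 : ∀ s, k s = 0 → 0 ≤ (w - k₂) s := by
    intro s hs
    have h := (tendsto_const_nhds (x := w s)).sub (hP.tendsto_cesaro hk₂ hwk s)
    refine ge_of_tendsto h ?_
    filter_upwards [eventually_gt_atTop 0] with n hn
    have hn' : (n : ℝ) ≠ 0 := by positivity
    -- Where `k s = 0`, the sum of the first `t` iterates of `v` is `w s - (w Pᵗ) s`. It is
    -- nonnegative, so no iterate of `w` exceeds `w` at `s`, and neither does their mean.
    have hle : ∑ t ∈ Finset.range n, (rowMap P)^[t] w s ≤ ∑ t ∈ Finset.range n, w s := by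
      refine Finset.sum_le_sum fun t _ => ?_
      have h := congrFun (sum_iterate hk hvk t) s
      simp only [Finset.sum_apply, Pi.add_apply, Pi.smul_apply, Pi.sub_apply, smul_eq_mul, hs,
        mul_zero, zero_add] at h
      linarith [Finset.sum_nonneg fun i (_ : i ∈ Finset.range t) => hP.iterate_nonneg hv i s]
    simp only [Finset.sum_const, Finset.card_range, nsmul_eq_mul] at hle
    have := mul_le_mul_of_nonneg_left hle (by positivity : (0 : ℝ) ≤ 1 / (n : ℝ))
    rw [← mul_assoc, one_div_mul_cancel hn', one_mul] at this
    linarith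
  -- Stationary vectors do not change `y - yP`. The multiple of `k` outweighs any negative entry
  -- where `k > 0`; terms with `k s = 0` contribute `0` to the coefficient, as division by zero
  -- gives `0`.
  refine ⟨k, (w - k₂) + (∑ s, |(w - k₂) s| / k s) • k, hk, hk0, fun s => ?_, ?_, hlim⟩
  · rcases (hk0 s).eq_or_lt with h | h
    · have := hy0 s h.symm
      simpa [← h] using this
    · have h1 : |(w - k₂) s| / k s ≤ ∑ s, |(w - k₂) s| / k s :=
        Finset.single_le_sum (f := fun s => |(w - k₂) s| / k s)
          (fun s _ => div_nonneg (abs_nonneg _) (hk0 s)) (Finset.mem_univ s)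
      have h2 := (div_le_iff₀ h).1 h1
      have h3 := neg_abs_le ((w - k₂) s)
      simp only [Pi.add_apply, Pi.smul_apply, smul_eq_mul]
      linarith
  · rw [map_add, map_sub, map_smul, hk, hk₂]
    nth_rewrite 1 [hvk]
    module

/-! ### Stationary vectors and closed sets -/

/-- A stationary vector carries no flow into a closed set. -/
theorem stationary_no_inflow (hP : IsStochastic P) {p : S → ℝ} (hp : ∀ s, 0 ≤ p s)
    (hst : rowMap P p = p) {B : Set S} (hB : ∀ s ∈ B, ∀ s', 0 < P s s' → s' ∈ B)
    {s s' : S} (hs : s ∉ B) (hs' : s' ∈ B) : p s * P s s' = 0 := by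
  classical
  set D := (Set.toFinite B).toFinset
  have hmem : ∀ s, s ∈ D ↔ s ∈ B := fun s => Set.Finite.mem_toFinset _
  -- Stationarity equates inflow and outflow of `B`, and a closed set has no outflow.
  have h := sum_flow_cut (fun s s' => p s * P s s') D
  have h1 : ∑ s' ∈ D, ∑ s, p s * P s s' = ∑ s' ∈ D, p s' :=
    Finset.sum_congr rfl fun s' _ => congrFun hst s'
  have h2 : ∑ s ∈ D, ∑ s', p s * P s s' = ∑ s ∈ D, p s := by
    simp [← Finset.mul_sum, hP.sum_one]
  have h3 : ∑ s ∈ D, ∑ s' ∈ Dᶜ, p s * P s s' = 0 := by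
    refine Finset.sum_eq_zero fun s hs => Finset.sum_eq_zero fun s' hs' => ?_
    have : ¬ 0 < P s s' := fun h =>
      Finset.mem_compl.1 hs' ((hmem s').2 (hB s ((hmem s).1 hs) s' h))
    rw [le_antisymm (not_lt.1 this) (hP.nonneg s s'), mul_zero]
  refine eq_zero_of_sum_sum_nonpos (q := fun s s' => p s * P s s') (D := Dᶜ) (E := D)
    (fun s _ s' _ => mul_nonneg (hp s) (hP.nonneg s s')) (by linarith) ?_ ((hmem s').2 hs')
  rw [Finset.mem_compl, hmem]
  exact hs

theorem stationary_pos_of_edge (hP : IsStochastic P) {p : S → ℝ} (hp : ∀ s, 0 ≤ p s)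
    (hst : rowMap P p = p) {s s' : S} (hs : 0 < p s) (h : 0 < P s s') : 0 < p s' := by
  rw [← hst, rowMap_apply]
  exact Finset.sum_pos' (fun s _ => mul_nonneg (hp s) (hP.nonneg s s'))
    ⟨s, Finset.mem_univ s, mul_pos hs h⟩

/-- In the support of a stationary vector, reachability is symmetric. -/
theorem stationary_reach_symm (hP : IsStochastic P) {p : S → ℝ} (hp : ∀ s, 0 ≤ p s)
    (hst : rowMap P p = p) {s s' : S} (hs : 0 < p s)
    (h : Relation.ReflTransGen (fun s s' => 0 < P s s') s s') :
    0 < p s' ∧ Relation.ReflTransGen (fun s s' => 0 < P s s') s' s := by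
  induction h with
  | refl => exact ⟨hs, .refl⟩
  | @tail b c _ hbc ih =>
    refine ⟨hP.stationary_pos_of_edge hp hst ih.1 hbc, ?_⟩
    refine Relation.ReflTransGen.trans ?_ ih.2
    -- Otherwise the edge from `b` to `c` would carry flow into the closed set of states reachable
    -- from `c`.
    by_contra hcb
    have := hP.stationary_no_inflow hp hst
      (B := {t | Relation.ReflTransGen (fun s s' => 0 < P s s') c t})
      (fun t ht t' h => Relation.ReflTransGen.tail ht h) hcb Relation.ReflTransGen.refl
    exact (mul_pos ih.1 hbc).ne' this

/-- Two stationary vectors without inflow into a strongly connected set `V` from outside, where the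
second is positive and both have the same mass, agree on `V`. -/
theorem stationary_unique (hP : IsStochastic P) {p x : S → ℝ} {V : Set S}
    (hpst : rowMap P p = p) (hxst : rowMap P x = x)
    (hpV : ∀ s ∉ V, ∀ s' ∈ V, p s * P s s' = 0) (hxV : ∀ s ∉ V, ∀ s' ∈ V, x s * P s s' = 0)
    (hx : ∀ s ∈ V, 0 < x s)
    (hV : StronglyConnectedOn (fun s s' => 0 < P s s') V) {D : Finset S} (hD : ∀ s, s ∈ D ↔ s ∈ V)
    (hmass : ∑ s ∈ D, p s = ∑ s ∈ D, x s) : ∀ s ∈ V, p s = x s := by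
  -- Minimum principle: with `c` the least ratio, `p - c x` is nonnegative on `V` and zero at `s₀`,
  -- and stationarity spreads a zero to all predecessors in `V`.
  obtain ⟨s₀, hs₀, hmin⟩ := Set.exists_min_image V (fun s => p s / x s) (Set.toFinite V) hV.1
  set c := p s₀ / x s₀ with hc
  have hz : ∀ s ∈ V, 0 ≤ p s - c * x s := fun s hs => by
    have := (le_div_iff₀ (hx s hs)).1 (hmin s hs)
    linarith
  have hpred : ∀ s ∈ V, ∀ s' ∈ V, 0 < P s s' → p s' - c * x s' = 0 → p s - c * x s = 0 := by
    intro s hs s' hs' hss' h0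
    have hsum : ∑ s, (p s - c * x s) * P s s' = 0 := by
      have h1 := congrFun hpst s'
      have h2 := congrFun hxst s'
      rw [rowMap_apply] at h1 h2
      simp only [sub_mul, Finset.sum_sub_distrib, mul_assoc, ← Finset.mul_sum, h1, h2, h0]
    have hnn : ∀ s ∈ Finset.univ, 0 ≤ (p s - c * x s) * P s s' := by
      intro t _
      by_cases ht : t ∈ V
      · exact mul_nonneg (hz t ht) (hP.nonneg t s')
      · rw [sub_mul, mul_assoc, hpV t ht s' hs', hxV t ht s' hs']
        simp
    have := (Finset.sum_eq_zero_iff_of_nonneg hnn).1 hsum s (Finset.mem_univ s)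
    exact (mul_eq_zero.1 this).resolve_right hss'.ne'
  have hall : ∀ s ∈ V, p s - c * x s = 0 := by
    intro s hs
    induction hV.2 s hs s₀ hs₀ using Relation.ReflTransGen.head_induction_on with
    | refl => rw [hc, div_mul_cancel₀ _ (hx s₀ hs₀).ne', sub_self]
    | head h _ ih => exact hpred _ h.1 _ h.2.1 h.2.2 (ih h.2.1)
  have hpos : 0 < ∑ s ∈ D, x s :=
    Finset.sum_pos (fun s hs => hx s ((hD s).1 hs)) ⟨s₀, (hD s₀).2 hs₀⟩
  have hc1 : c = 1 := by
    have : ∑ s ∈ D, p s = c * ∑ s ∈ D, x s := by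
      rw [Finset.mul_sum]
      exact Finset.sum_congr rfl fun s hs => by linarith [hall s ((hD s).1 hs)]
    rw [hmass] at this
    exact (mul_eq_right₀ hpos.ne').1 this.symm
  intro s hs
  have := hall s hs
  rw [hc1] at this
  linarith

/-- If `d` is invariant on the complement of `r`, for the part of the flow that starts there,
then it carries no flow into `r`. -/
theorem no_outflow (hP : IsStochastic P) {d : S → ℝ} {r : Set S} (hr : ∀ s ∈ r, d s = 0)
    (hd : ∀ s' ∉ r, rowMap P d s' = d s') {s s' : S} (hs : s ∉ r) (hs' : s' ∈ r) :
    d s * P s s' = 0 := by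
  classical
  set D := (Set.toFinite rᶜ).toFinset
  have hmem : ∀ s, s ∈ D ↔ s ∉ r := fun s => Set.Finite.mem_toFinset _
  -- As `d` is signed, the cut is balanced for `|d|`: the mass on `D` is at most what flows into
  -- `D`, which is that mass minus the leak into `r`.
  have h := sum_flow_cut (fun s s' => |d s| * P s s') D
  have h1 : ∑ s' ∈ D, |d s'| ≤ ∑ s' ∈ D, ∑ s, |d s| * P s s' := by
    refine Finset.sum_le_sum fun s' hs' => ?_
    rw [← hd s' ((hmem s').1 hs'), rowMap_apply]
    refine (Finset.abs_sum_le_sum_abs _ _).trans (Finset.sum_le_sum fun s _ => ?_)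
    rw [abs_mul, abs_of_nonneg (hP.nonneg s s')]
  have h2 : ∑ s ∈ D, ∑ s', |d s| * P s s' = ∑ s ∈ D, |d s| := by
    simp [← Finset.mul_sum, hP.sum_one]
  have h3 : ∑ s ∈ Dᶜ, ∑ s' ∈ D, |d s| * P s s' = 0 := by
    refine Finset.sum_eq_zero fun s hs => Finset.sum_eq_zero fun s' _ => ?_
    rw [hr s (by simpa [hmem] using hs), abs_zero, zero_mul]
  have h4 : |d s| * P s s' = 0 :=
    eq_zero_of_sum_sum_nonpos (q := fun s s' => |d s| * P s s') (D := D) (E := Dᶜ)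
      (fun s _ s' _ => mul_nonneg (abs_nonneg _) (hP.nonneg s s')) (by linarith) ((hmem s).2 hs)
      (by simpa [hmem] using hs')
  rcases mul_eq_zero.1 h4 with h | h
  · rw [abs_eq_zero.1 h, zero_mul]
  · rw [h, mul_zero]

end IsStochastic

/-! ### Strongly connected components -/

theorem IsSCC.eq_of_mem {S : Type*} {E : S → S → Prop} {C D : Set S} (hC : IsSCC E C)
    (hD : IsSCC E D) {s : S} (hsC : s ∈ C) (hsD : s ∈ D) : C = D := by
  have hU : ∀ t ∈ C ∪ D, ∀ t' ∈ C ∪ D, Relation.ReflTransGen E t t' := by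
    have h1 : ∀ t ∈ C ∪ D, Relation.ReflTransGen E t s ∧ Relation.ReflTransGen E s t := by
      rintro t (ht | ht)
      · exact ⟨hC.prop t ht s hsC, hC.prop s hsC t ht⟩
      · exact ⟨hD.prop t ht s hsD, hD.prop s hsD t ht⟩
    exact fun t ht t' ht' => (h1 t ht).1.trans (h1 t' ht').2
  rw [hC.eq_of_subset hU Set.subset_union_left]
  exact (hD.eq_of_subset hU Set.subset_union_right).symm

theorem mem_of_reach {S : Type*} {E : S → S → Prop} {C : Set S}
    (hC : ∀ s ∈ C, ∀ s', E s s' → s' ∈ C) {s s' : S} (hs : s ∈ C)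
    (h : Relation.ReflTransGen E s s') : s' ∈ C := by
  induction h with
  | refl => exact hs
  | tail _ h ih => exact hC _ ih _ h

/-- Closedness gives maximality: a larger mutually reachable set would have to be reached from `C`.
-/
theorem IsSCC.of_closed {S : Type*} {E : S → S → Prop} {C : Set S} (hne : C.Nonempty)
    (hconn : ∀ s ∈ C, ∀ s' ∈ C, Relation.ReflTransGen E s s')
    (hC : ∀ s ∈ C, ∀ s', E s s' → s' ∈ C) : IsSCC E C := by
  obtain ⟨s, hs⟩ := hne
  exact ⟨hconn, fun D hD hCD t ht => mem_of_reach hC hs (hD s (hCD hs) t ht)⟩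

namespace MDP

variable {S A : Type*} [Fintype S] {M : MDP S A}

/-! ### Flows of state-action vectors -/

/-- The flow from `s` to `s'` of the state-action vector `z`. -/
def flux (M : MDP S A) (z : S → A → ℝ) (s s' : S) : ℝ := ∑ a ∈ M.act s, z s a * M.T s a s'

theorem flux_nonneg {z : S → A → ℝ} (hz : ∀ s, ∀ a ∈ M.act s, 0 ≤ z s a) (s s' : S) :
    0 ≤ M.flux z s s' :=
  Finset.sum_nonneg fun a ha => mul_nonneg (hz s a ha) (M.T_nonneg s a ha s')

theorem sum_flux (z : S → A → ℝ) (s : S) : ∑ s', M.flux z s s' = M.tot z s := by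
  simp only [flux, tot]
  rw [Finset.sum_comm]
  refine Finset.sum_congr rfl fun a ha => ?_
  rw [← Finset.mul_sum, M.T_sum s a ha, mul_one]

theorem flux_eq {z π : S → A → ℝ} {s : S} {c : ℝ} (h : ∀ a ∈ M.act s, z s a = c * π s a)
    (s' : S) : M.flux z s s' = c * M.chainT π s s' := by
  rw [flux, chainT, Finset.mul_sum]
  exact Finset.sum_congr rfl fun a ha => by rw [h a ha]; ring

theorem flux_eq_zero_of_closed {C : Set S} (hC : ∀ s ∈ C, ∀ s', M.edge s s' → s' ∈ C)
    (z : S → A → ℝ) {s s' : S} (hs : s ∈ C) (hs' : s' ∉ C) : M.flux z s s' = 0 := by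
  refine Finset.sum_eq_zero fun a ha => ?_
  have : ¬ 0 < M.T s a s' := fun h => hs' (hC s hs s' ⟨a, ha, h⟩)
  rw [le_antisymm (not_lt.1 this) (M.T_nonneg s a ha s'), mul_zero]

theorem tot_nonneg {z : S → A → ℝ} (hz : ∀ s, ∀ a ∈ M.act s, 0 ≤ z s a) (s : S) :
    0 ≤ M.tot z s := Finset.sum_nonneg (hz s)

theorem IsPolicy.tot_mul {π : S → A → ℝ} (hπ : M.IsPolicy π) (k : S → ℝ) (s : S) :
    M.tot (fun s a => k s * π s a) s = k s := by
  simp only [tot, ← Finset.mul_sum, (hπ s).2.2, mul_one]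

namespace InQ0

variable {x y : S → A → ℝ}

theorem x_nonneg (h : M.InQ0 x y) (s : S) (a : A) (ha : a ∈ M.act s) : 0 ≤ x s a :=
  (h.x_mem s a ha).1

theorem sum_flux_x (h : M.InQ0 x y) (s' : S) : ∑ s, M.flux x s s' = M.tot x s' := h.balance s'

theorem sum_flux_y (h : M.InQ0 x y) (s' : S) :
    ∑ s, M.flux y s s' = M.tot x s' + M.tot y s' - M.β s' := by
  rw [tot, tot, ← Finset.sum_add_distrib]
  exact h.flow s'

theorem tot_eq_zero (h : M.InQ0 x y) {s : S} (hs : s ∉ M.recSet) : M.tot x s = 0 := by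
  have h0 := h.trans
  rw [finsum_mem_eq_finite_toFinset_sum _ (Set.toFinite _)] at h0
  exact (Finset.sum_eq_zero_iff_of_nonneg fun s _ => tot_nonneg h.x_nonneg s).1 h0 s
    ((Set.Finite.mem_toFinset _).2 hs)

end InQ0

/-! ### The Markov chain of a policy -/

theorem IsPolicy.isStochastic {π : S → A → ℝ} (hπ : M.IsPolicy π) :
    IsStochastic (M.chainT π) where
  nonneg s s' := Finset.sum_nonneg fun a ha => mul_nonneg (M.T_nonneg s a ha s') ((hπ s).1 a)
  sum_one s := by
    simp only [chainT]
    rw [Finset.sum_comm, ← (hπ s).2.2]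
    refine Finset.sum_congr rfl fun a ha => ?_
    rw [← Finset.sum_mul, M.T_sum s a ha, one_mul]

theorem IsPolicy.edge_of_chainEdge {π : S → A → ℝ} (hπ : M.IsPolicy π) {s s' : S}
    (h : M.chainEdge π s s') : M.edge s s' := by
  obtain ⟨a, ha, h0⟩ := Finset.exists_lt_of_sum_lt (f := fun _ => (0 : ℝ))
    (by simpa [chainEdge, chainT] using h : ∑ a ∈ M.act s, (0 : ℝ) < ∑ a ∈ M.act s, M.T s a s' * π s a)
  exact ⟨a, ha, pos_of_mul_pos_left h0 ((hπ s).1 a)⟩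

theorem IsPolicy.chainEdge_of_pos {π : S → A → ℝ} (hπ : M.IsPolicy π) {s s' : S} {a : A}
    (ha : a ∈ M.act s) (hπa : 0 < π s a) (hT : 0 < M.T s a s') : M.chainEdge π s s' :=
  Finset.sum_pos' (fun a ha => mul_nonneg (M.T_nonneg s a ha s') ((hπ s).1 a))
    ⟨a, ha, mul_pos hT hπa⟩

theorem stateProb_eq (π : S → A → ℝ) (t : ℕ) :
    M.stateProb π t = (rowMap (M.chainT π))^[t] M.β := by
  induction t with
  | zero => rfl
  | succ t ih =>
    rw [Function.iterate_succ_apply', ← ih]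
    rfl

theorem IsPolicy.exists_reach {π : S → A → ℝ} (hπ : M.IsPolicy π) {t : ℕ} {s : S}
    (h : 0 < (rowMap (M.chainT π))^[t] M.β s) :
    ∃ s₀, 0 < M.β s₀ ∧ Relation.ReflTransGen (M.chainEdge π) s₀ s := by
  induction t generalizing s with
  | zero => exact ⟨s, h, .refl⟩
  | succ t ih =>
    rw [Function.iterate_succ_apply', rowMap_apply] at h
    obtain ⟨r, _, hr⟩ := Finset.exists_lt_of_sum_lt (f := fun _ => (0 : ℝ)) (by simpa using h)
    have hr0 := hπ.isStochastic.iterate_nonneg M.β_nonneg t r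
    have hP0 := hπ.isStochastic.nonneg r s
    obtain ⟨s₀, hs₀, hreach⟩ := ih (pos_of_mul_pos_left hr hP0)
    exact ⟨s₀, hs₀, hreach.tail (pos_of_mul_pos_right hr hr0)⟩

/-! ### Steady states as points of `Q₀` -/

/-- A stationary policy whose recurrent states are recurrent in the MDP has a steady-state
distribution, which is the `x`-part of a point of `Q₀` governed by the policy. -/
theorem IsPolicy.exists_steadyState {π : S → A → ℝ} (hπ : M.IsPolicy π)
    (hrec : M.chainRecSet π ⊆ M.recSet) :
    ∃ k y : S → ℝ, rowMap (M.chainT π) k = k ∧ (∀ s, 0 ≤ k s) ∧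
      (∀ s, 0 < k s → s ∈ M.chainRecSet π) ∧
      M.IsSteadyState π (fun s a => k s * π s a) ∧
      M.InQ0 (fun s a => k s * π s a) (fun s a => y s * π s a) := by
  have hP := hπ.isStochastic
  obtain ⟨k, y, hst, hk, hy, hky, hlim⟩ := hP.exists_limit M.β_nonneg
  have hkrec : ∀ s, 0 < k s → s ∈ M.chainRecSet π := by
    intro s hs
    obtain ⟨s₀, hs₀, hreach⟩ :
        ∃ s₀, 0 < M.β s₀ ∧ Relation.ReflTransGen (M.chainEdge π) s₀ s := by
      obtain ⟨n, hn⟩ := ((hlim s).eventually (lt_mem_nhds hs)).exists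
      have hn' := pos_of_mul_pos_right hn (by positivity : (0 : ℝ) ≤ 1 / (n : ℝ))
      obtain ⟨t, _, ht⟩ := Finset.exists_lt_of_sum_lt (f := fun _ => (0 : ℝ)) (by simpa using hn')
      exact hπ.exists_reach ht
    -- The states reachable from `s` form the TSCC; each leads back to `s` because `k` is stationary
    -- and positive at `s`.
    refine ⟨{t | Relation.ReflTransGen (M.chainEdge π) s t}, ⟨IsSCC.of_closed ⟨s, .refl⟩ ?_ ?_,
      ⟨s₀, hs₀, s, .refl, hreach⟩, ?_⟩, .refl⟩
    · exact fun t ht t' ht' => (hP.stationary_reach_symm hk hst hs ht).2.trans ht'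
    · exact fun t ht t' h => Relation.ReflTransGen.tail ht h
    · exact fun t ht t' h => Relation.ReflTransGen.tail ht h
  have hk1 : ∀ s, k s ≤ 1 := by
    intro s
    have h1 : ∑ s, (M.β - k) s = 0 := by
      rw [hky]
      simp [hP.sum_rowMap]
    simp only [Pi.sub_apply, Finset.sum_sub_distrib, M.β_sum] at h1
    have h2 := Finset.single_le_sum (fun s _ => hk s) (Finset.mem_univ s)
    linarith
  have hflux : ∀ (z : S → ℝ) (s' : S),
      ∑ s, ∑ a ∈ M.act s, z s * π s a * M.T s a s' = rowMap (M.chainT π) z s' := by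
    intro z s'
    rw [rowMap_apply]
    exact Finset.sum_congr rfl fun s _ =>
      flux_eq (z := fun s a => z s * π s a) (fun a _ => rfl) s'
  refine ⟨k, y, hst, hk, hkrec, fun s a _ => ?_, ?_, ?_, ?_, ?_, ?_⟩
  · refine ((hlim s).mul_const (π s a)).congr fun n => ?_
    simp only [stateActProb, stateProb_eq]
    rw [mul_assoc, Finset.sum_mul]
  · intro s'
    rw [hflux, hst]
    exact (hπ.tot_mul k s').symm
  · intro s'
    rw [hflux, Finset.sum_add_distrib]
    have h1 := hπ.tot_mul k s'
    have h2 := hπ.tot_mul y s'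
    have h3 := congrFun hky s'
    simp only [tot, Pi.sub_apply] at h1 h2 h3
    rw [h1, h2]
    linarith
  · refine finsum_mem_eq_zero_of_forall_eq_zero fun s hs => ?_
    have h0 : k s = 0 := le_antisymm (not_lt.1 fun h => hs (hrec (hkrec s h))) (hk s)
    simp [h0]
  · intro s a ha
    have hπ1 : π s a ≤ 1 := by
      rw [← (hπ s).2.2]
      exact Finset.single_le_sum (fun a _ => (hπ s).1 a) ha
    exact ⟨mul_nonneg (hk s) ((hπ s).1 a), mul_le_one₀ (hk1 s) ((hπ s).1 a) hπ1⟩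
  · exact fun s a _ => mul_nonneg (hy s) ((hπ s).1 a)

/-- The expected average reward is the objective value of the steady-state distribution. -/
theorem IsSteadyState.avgReward_eq {π p : S → A → ℝ} (h : M.IsSteadyState π p) :
    M.avgReward π = M.objective p := by
  refine Tendsto.liminf_eq ?_
  have h1 : Tendsto (fun n : ℕ => ∑ s, ∑ a ∈ M.act s, ((1 / (n : ℝ)) *
      ∑ t ∈ Finset.Icc 1 n, M.stateActProb π t s a) * M.meanR s a) atTop
      (𝓝 (M.objective p)) :=
    tendsto_finsetSum _ fun s _ => tendsto_finsetSum _ fun a ha => (h s a ha).mul_const _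
  refine h1.congr fun n => ?_
  rw [Finset.sum_comm (s := Finset.Icc 1 n), Finset.mul_sum]
  refine Finset.sum_congr rfl fun s _ => ?_
  rw [Finset.sum_comm (s := Finset.Icc 1 n), Finset.mul_sum]
  refine Finset.sum_congr rfl fun a _ => ?_
  rw [mul_assoc, Finset.sum_mul]

theorem IsSteadyState.congr_right {π p q : S → A → ℝ} (hp : M.IsSteadyState π p)
    (hpq : ∀ s, ∀ a ∈ M.act s, p s a = q s a) : M.IsSteadyState π q :=
  fun s a ha => hpq s a ha ▸ hp s a ha

/-- Two points of `Q₀` whose `y`-parts follow the same policy at the transient states of the MDP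
give the same mass to each TSCC. -/
theorem InQ0.mass_eq {x y x' y' π : S → A → ℝ} (hπ : M.IsPolicy π) (h : M.InQ0 x y)
    (h' : M.InQ0 x' y') (hy : ∀ s ∉ M.recSet, ∀ a ∈ M.act s, y s a = M.tot y s * π s a)
    (hy' : ∀ s ∉ M.recSet, ∀ a ∈ M.act s, y' s a = M.tot y' s * π s a)
    {C : Set S} (hC : M.IsTSCCOf C) {D : Finset S} (hD : ∀ s, s ∈ D ↔ s ∈ C) :
    ∑ s ∈ D, M.tot x s = ∑ s ∈ D, M.tot x' s := by
  classical
  have hrec : ∀ s ∈ M.recSet, ∀ s', M.edge s s' → s' ∈ M.recSet :=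
    fun s ⟨B, hB, hs⟩ s' hss' => ⟨B, hB, hB.2.2 s hs s' hss'⟩
  -- Setting `d` to zero on `r(M)` is harmless for flow to states outside `r(M)`, since nothing
  -- leaves `r(M)`.
  set d : S → ℝ := fun s => if s ∈ M.recSet then 0 else M.tot y s - M.tot y' s with hd
  have hflux : ∀ s s', (s' ∉ M.recSet ∨ s ∉ M.recSet) →
      M.flux y s s' - M.flux y' s s' = d s * M.chainT π s s' := by
    intro s s' hss'
    by_cases hs : s ∈ M.recSet
    · have hs' := hss'.resolve_right (not_not.2 hs)
      simp [hd, hs, flux_eq_zero_of_closed hrec _ hs hs']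
    · simp only [hd, if_neg hs, flux_eq (hy s hs), flux_eq (hy' s hs)]
      ring
  have hout : ∀ s ∉ M.recSet, ∀ s' ∈ M.recSet, d s * M.chainT π s s' = 0 := by
    intro s hs s' hs'
    refine hπ.isStochastic.no_outflow (fun s hs => by simp [hd, hs]) (fun t ht => ?_) hs hs'
    have e1 := h.sum_flux_y t
    have e2 := h'.sum_flux_y t
    rw [h.tot_eq_zero ht] at e1
    rw [h'.tot_eq_zero ht] at e2
    rw [rowMap_apply, ← Finset.sum_congr rfl fun s _ => hflux s t (.inl ht),
      Finset.sum_sub_distrib, e1, e2]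
    simp only [hd, if_neg ht]
    ring
  have hin : ∀ s ∉ C, ∀ s' ∈ C, M.flux y s s' = M.flux y' s s' := by
    intro s hs s' hs'
    by_cases hsr : s ∈ M.recSet
    · obtain ⟨B, hB, hsB⟩ := hsr
      have hs'B : s' ∉ B := fun hm => hs (hB.1.eq_of_mem hC.1 hm hs' ▸ hsB)
      rw [flux_eq_zero_of_closed hB.2.2 y hsB hs'B, flux_eq_zero_of_closed hB.2.2 y' hsB hs'B]
    · have := hflux s s' (.inr hsr)
      rw [hout s hsr s' ⟨C, hC, hs'⟩] at this
      linarith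
  have hmass : ∀ {x y : S → A → ℝ}, M.InQ0 x y →
      ∑ s ∈ D, M.tot x s = ∑ s ∈ D, M.β s + ∑ s ∈ Dᶜ, ∑ s' ∈ D, M.flux y s s' := by
    intro x y h
    have e := sum_flow_cut (M.flux y) D
    have e3 : ∑ s ∈ D, ∑ s' ∈ Dᶜ, M.flux y s s' = 0 :=
      Finset.sum_eq_zero fun s hs => Finset.sum_eq_zero fun s' hs' =>
        flux_eq_zero_of_closed hC.2.2 y ((hD s).1 hs) fun hm =>
          Finset.mem_compl.1 hs' ((hD s').2 hm)
    simp only [h.sum_flux_y, sum_flux, Finset.sum_sub_distrib, Finset.sum_add_distrib] at e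
    linarith
  rw [hmass h, hmass h']
  congr 1
  refine Finset.sum_congr rfl fun s hs => Finset.sum_congr rfl fun s' hs' => ?_
  exact hin s (fun hm => Finset.mem_compl.1 hs ((hD s).2 hm)) s' ((hD s').1 hs')

end MDP

namespace MDP

variable {S A : Type*} [Fintype S] {M : MDP S A}

/-! ### The policy of a point of `Q₀` -/

namespace IsPolicyFrom

variable {x y π : S → A → ℝ}

theorem x_eq (hπ : M.IsPolicyFrom x y π) (h : M.InQ0 x y) (s : S) :
    ∀ a ∈ M.act s, x s a = M.tot x s * π s a := by
  intro a ha
  rcases (tot_nonneg h.x_nonneg s).eq_or_lt with h0 | h0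
  · rw [← h0, zero_mul]
    exact (Finset.sum_eq_zero_iff_of_nonneg (h.x_nonneg s)).1 h0.symm a ha
  · rw [hπ.2.1 s h0 a ha, mul_div_cancel₀ _ h0.ne']

theorem y_eq (hπ : M.IsPolicyFrom x y π) (h : M.InQ0 x y) {s : S} (hs : ¬ 0 < M.tot x s) :
    ∀ a ∈ M.act s, y s a = M.tot y s * π s a := by
  intro a ha
  rcases (tot_nonneg h.y_nonneg s).eq_or_lt with h0 | h0
  · rw [← h0, zero_mul]
    exact (Finset.sum_eq_zero_iff_of_nonneg (h.y_nonneg s)).1 h0.symm a ha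
  · rw [hπ.2.2 s hs h0 a ha, mul_div_cancel₀ _ h0.ne']

theorem stationary (hπ : M.IsPolicyFrom x y π) (h : M.InQ0 x y) :
    rowMap (M.chainT π) (M.tot x) = M.tot x := by
  ext s'
  rw [rowMap_apply, ← h.sum_flux_x s']
  exact Finset.sum_congr rfl fun s _ => (flux_eq (hπ.x_eq h s) s').symm

theorem tot_pos_of_chainEdge (hπ : M.IsPolicyFrom x y π) (h : M.InQ0 x y) {s s' : S}
    (hs : 0 < M.tot x s) (hss' : M.chainEdge π s s') : 0 < M.tot x s' :=
  hπ.1.isStochastic.stationary_pos_of_edge (tot_nonneg h.x_nonneg) (hπ.stationary h) hs hss'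

theorem supportVerts_closed (hπ : M.IsPolicyFrom x y π) (h : M.InQ0 x y) {C : Set S}
    (hC : M.IsTSCCOf C) : ∀ s ∈ M.supportVerts x C, ∀ s', M.chainEdge π s s' →
      s' ∈ M.supportVerts x C :=
  fun s hs s' hss' => ⟨hC.2.2 s hs.1 s' (hπ.1.edge_of_chainEdge hss'),
    hπ.tot_pos_of_chainEdge h hs.2 hss'⟩

theorem stronglyConnectedOn_chainEdge (hπ : M.IsPolicyFrom x y π) {C : Set S}
    (hconn : StronglyConnectedOn (M.supportEdge x) (M.supportVerts x C)) :
    StronglyConnectedOn (M.chainEdge π) (M.supportVerts x C) := by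
  refine ⟨hconn.1, fun s hs s' hs' => Relation.ReflTransGen.mono ?_ _ _ (hconn.2 s hs s' hs')⟩
  rintro v w ⟨hv, hw, a, ha, hxa, hT⟩
  refine ⟨hv, hw, hπ.1.chainEdge_of_pos ha ?_ hT⟩
  rw [hπ.2.1 v hv.2 a ha]
  exact div_pos hxa hv.2

/-- Each set `V_C⁺(x)` is a TSCC of the chain. -/
theorem isTSCCOfChain_supportVerts (hπ : M.IsPolicyFrom x y π) (h : M.InQ0 x y) {C : Set S}
    (hC : M.IsTSCCOf C)
    (hconn : StronglyConnectedOn (M.supportEdge x) (M.supportVerts x C)) :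
    M.IsTSCCOfChain π (M.supportVerts x C) := by
  classical
  have hclosed := hπ.supportVerts_closed h hC
  have hV := hπ.stronglyConnectedOn_chainEdge hconn
  have hpath : ∀ s ∈ M.supportVerts x C, ∀ s' ∈ M.supportVerts x C,
      Relation.ReflTransGen (M.chainEdge π) s s' :=
    fun s hs s' hs' => Relation.ReflTransGen.mono (fun _ _ h => h.2.2) _ _ (hV.2 s hs s' hs')
  refine ⟨IsSCC.of_closed hV.1 hpath hclosed, ?_, hclosed⟩
  by_contra hno
  -- If the support were unreachable from `β`, the set `W` of its ancestors would have neither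
  -- initial mass nor inflow of `y`, although the flow equation needs a source for the positive
  -- `x`-mass in `W`.
  set W : Set S := {s | ∃ v ∈ M.supportVerts x C, Relation.ReflTransGen (M.chainEdge π) s v}
  have hβ : ∀ s ∈ W, M.β s = 0 := fun s ⟨v, hv, hsv⟩ =>
    le_antisymm (not_lt.1 fun hs => hno ⟨s, hs, v, hv, hsv⟩) (M.β_nonneg s)
  have hin : ∀ s ∉ W, ∀ s' ∈ W, M.flux y s s' = 0 := by
    rintro s hs s' ⟨v, hv, hsv⟩
    by_cases hx : 0 < M.tot x s
    · obtain ⟨B, hB, hsB⟩ : s ∈ M.recSet := by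
        by_contra hs'
        exact hx.ne' (h.tot_eq_zero hs')
      refine flux_eq_zero_of_closed hB.2.2 y hsB fun hs'B => hs ?_
      -- An edge from `B` into `W` that stays in `B` leads on to `C`; then `B = C`, and `s` is
      -- itself in the support.
      have hvB : v ∈ B :=
        mem_of_reach (fun t ht t' e => hB.2.2 t ht t' (hπ.1.edge_of_chainEdge e)) hs'B hsv
      have hBC : B = C := hB.1.eq_of_mem hC.1 hvB hv.1
      exact ⟨v, hv, hpath s ⟨hBC ▸ hsB, hx⟩ v hv⟩
    · rw [flux_eq (hπ.y_eq h hx)]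
      have : ¬ 0 < M.chainT π s s' := fun e => hs ⟨v, hv, hsv.head e⟩
      rw [le_antisymm (not_lt.1 this) (hπ.1.isStochastic.nonneg s s'), mul_zero]
  set D := (Set.toFinite W).toFinset
  have hmem : ∀ s, s ∈ D ↔ s ∈ W := fun s => Set.Finite.mem_toFinset _
  have e := sum_flow_cut (M.flux y) D
  have e1 : ∑ s ∈ Dᶜ, ∑ s' ∈ D, M.flux y s s' = 0 :=
    Finset.sum_eq_zero fun s hs => Finset.sum_eq_zero fun s' hs' =>
      hin s (fun hm => Finset.mem_compl.1 hs ((hmem s).2 hm)) s' ((hmem s').1 hs')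
  have e2 : 0 ≤ ∑ s ∈ D, ∑ s' ∈ Dᶜ, M.flux y s s' :=
    Finset.sum_nonneg fun s _ => Finset.sum_nonneg fun s' _ => flux_nonneg h.y_nonneg s s'
  have e3 : ∑ s ∈ D, M.β s = 0 := Finset.sum_eq_zero fun s hs => hβ s ((hmem s).1 hs)
  have e4 : 0 < ∑ s ∈ D, M.tot x s := by
    obtain ⟨v, hv⟩ := hV.1
    exact Finset.sum_pos' (fun s _ => tot_nonneg h.x_nonneg s)
      ⟨v, (hmem v).2 ⟨v, hv, .refl⟩, hv.2⟩
  simp only [h.sum_flux_y, sum_flux, Finset.sum_sub_distrib, Finset.sum_add_distrib] at e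
  linarith

/-- An edge of the chain leaving the support of `x` or `y` ends in the support of `x` or carries
flow of `y`. -/
theorem flux_pos_or (hπ : M.IsPolicyFrom x y π) (h : M.InQ0 x y) {s s' : S}
    (hs : 0 < M.tot x s ∨ 0 < M.tot y s) (hss' : M.chainEdge π s s') :
    0 < M.tot x s' ∨ 0 < M.flux y s s' := by
  by_cases hx : 0 < M.tot x s
  · exact .inl (hπ.tot_pos_of_chainEdge h hx hss')
  · refine .inr ?_
    rw [flux_eq (hπ.y_eq h hx)]
    exact mul_pos (hs.resolve_left hx) hss'

/-- States visited by the chain carry a positive amount of `x` or `y`. -/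
theorem pos_of_reach (hπ : M.IsPolicyFrom x y π) (h : M.InQ0 x y) {s₀ s : S} (hs₀ : 0 < M.β s₀)
    (hreach : Relation.ReflTransGen (M.chainEdge π) s₀ s) :
    0 < M.tot x s ∨ 0 < M.tot y s := by
  have hsum : ∀ s, 0 < M.tot x s + M.tot y s → 0 < M.tot x s ∨ 0 < M.tot y s := by
    intro s hs
    by_contra! hc
    linarith [hc.1, hc.2]
  induction hreach with
  | refl =>
    have := h.sum_flux_y s₀
    have h0 := Finset.sum_nonneg fun s (_ : s ∈ Finset.univ) => flux_nonneg h.y_nonneg s s₀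
    exact hsum s₀ (by linarith)
  | @tail b c _ hbc ih =>
    rcases hπ.flux_pos_or h ih hbc with hx | hy
    · exact .inl hx
    · have := h.sum_flux_y c
      have h0 := Finset.single_le_sum (fun s _ => flux_nonneg h.y_nonneg s c)
        (Finset.mem_univ b)
      exact hsum c (by linarith [M.β_nonneg c])

/-- Each TSCC of the chain meets the support of `x`. -/
theorem exists_tot_pos (hπ : M.IsPolicyFrom x y π) (h : M.InQ0 x y) {B : Set S}
    (hB : M.IsTSCCOfChain π B) : ∃ s ∈ B, 0 < M.tot x s := by
  classical
  by_contra! hno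
  set D := (Set.toFinite B).toFinset
  have hmem : ∀ s, s ∈ D ↔ s ∈ B := fun s => Set.Finite.mem_toFinset _
  have e := sum_flow_cut (M.flux y) D
  have e1 : ∑ s ∈ D, ∑ s' ∈ Dᶜ, M.flux y s s' = 0 := by
    refine Finset.sum_eq_zero fun s hs => Finset.sum_eq_zero fun s' hs' => ?_
    have hsB := (hmem s).1 hs
    rw [flux_eq (hπ.y_eq h (not_lt.2 (hno s hsB)))]
    have : ¬ 0 < M.chainT π s s' := fun e =>
      Finset.mem_compl.1 hs' ((hmem s').2 (hB.2.2 s hsB s' e))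
    rw [le_antisymm (not_lt.1 this) (hπ.1.isStochastic.nonneg s s'), mul_zero]
  have e2 : ∑ s ∈ D, M.tot x s = 0 := Finset.sum_eq_zero fun s hs =>
    le_antisymm (hno s ((hmem s).1 hs)) (tot_nonneg h.x_nonneg s)
  simp only [h.sum_flux_y, sum_flux, Finset.sum_sub_distrib, Finset.sum_add_distrib] at e
  have e3 := Finset.sum_nonneg fun s (_ : s ∈ D) => M.β_nonneg s
  have e4 : 0 ≤ ∑ s ∈ Dᶜ, ∑ s' ∈ D, M.flux y s s' :=
    Finset.sum_nonneg fun s _ => Finset.sum_nonneg fun s' _ => flux_nonneg h.y_nonneg s s'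
  -- With no `x` on `B` and no outflow, the flow equation says that `β(B)` plus the inflow of `y` is
  -- zero.
  have hβ : ∀ s ∈ B, M.β s = 0 := fun s hs =>
    (Finset.sum_eq_zero_iff_of_nonneg fun s _ => M.β_nonneg s).1 (by linarith) s ((hmem s).2 hs)
  have hin : ∀ s ∉ B, ∀ s' ∈ B, M.flux y s s' = 0 := fun s hs s' hs' =>
    eq_zero_of_sum_sum_nonpos (D := Dᶜ) (E := D)
      (fun s _ s' _ => flux_nonneg h.y_nonneg s s') (by linarith)
      (Finset.mem_compl.2 fun hm => hs ((hmem s).1 hm)) ((hmem s').2 hs')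
  obtain ⟨s₀, hs₀, s, hs, hreach⟩ := hB.2.1
  -- A path from an initial state cannot enter `B`: the entering edge would end in the support of
  -- `x` or carry `y`-flow.
  have hout : ∀ t, Relation.ReflTransGen (M.chainEdge π) s₀ t → t ∉ B := by
    intro t ht
    induction ht with
    | refl => exact fun hm => hs₀.ne' (hβ s₀ hm)
    | @tail b c hb hbc ih =>
      intro hc
      rcases hπ.flux_pos_or h (hπ.pos_of_reach h hs₀ hb) hbc with hx | hy
      · exact (hno c hc).not_gt hx
      · exact hy.ne' (hin b ih c hc)
  exact hout s hreach hs

/-- The TSCCs of the chain are among the sets `V_C⁺(x)`. -/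
theorem exists_eq_supportVerts (hπ : M.IsPolicyFrom x y π) (h : M.InQ0 x y)
    (hconn : ∀ C : Set S, M.IsTSCCOf C →
      StronglyConnectedOn (M.supportEdge x) (M.supportVerts x C))
    {B : Set S} (hB : M.IsTSCCOfChain π B) :
    ∃ C, M.IsTSCCOf C ∧ B = M.supportVerts x C := by
  obtain ⟨s, hs, hx⟩ := hπ.exists_tot_pos h hB
  obtain ⟨C, hC, hsC⟩ : s ∈ M.recSet := by
    by_contra hs'
    exact hx.ne' (h.tot_eq_zero hs')
  exact ⟨C, hC, hB.1.eq_of_mem (hπ.isTSCCOfChain_supportVerts h hC (hconn C hC)).1 hs ⟨hsC, hx⟩⟩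

theorem mem_CPU (hπ : M.IsPolicyFrom x y π) (h : M.InQ0 x y)
    (hconn : ∀ C : Set S, M.IsTSCCOf C →
      StronglyConnectedOn (M.supportEdge x) (M.supportVerts x C)) : π ∈ M.CPU := by
  refine ⟨hπ.1, ?_, fun C hC => ⟨M.supportVerts x C,
    ⟨hπ.isTSCCOfChain_supportVerts h hC (hconn C hC), fun s hs => hs.1⟩, ?_⟩⟩
  · rintro s ⟨B, hB, hs⟩
    obtain ⟨C, hC, rfl⟩ := hπ.exists_eq_supportVerts h hconn hB
    exact ⟨C, hC, hs.1⟩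
  · rintro B ⟨hB, hBC⟩
    obtain ⟨C', hC', rfl⟩ := hπ.exists_eq_supportVerts h hconn hB
    obtain ⟨v, hv⟩ := (hconn C' hC').1
    rw [hC'.1.eq_of_mem hC.1 hv.1 (hBC hv)]

/-- The steady-state distribution of the policy `π(x, y)` is `x`. -/
theorem isSteadyState (hπ : M.IsPolicyFrom x y π) (h : M.InQ0 x y)
    (hconn : ∀ C : Set S, M.IsTSCCOf C →
      StronglyConnectedOn (M.supportEdge x) (M.supportVerts x C)) : M.IsSteadyState π x := by
  have hP := hπ.1.isStochastic
  obtain ⟨k, z, hst, hk, hkrec, hss, hQ⟩ :=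
    hπ.1.exists_steadyState (hπ.mem_CPU h hconn).2.1
  have hkx : ∀ s, ¬ 0 < M.tot x s → k s = 0 := by
    intro s hs
    refine le_antisymm (not_lt.1 fun hks => hs ?_) (hk s)
    obtain ⟨B, hB, hsB⟩ := hkrec s hks
    obtain ⟨C, hC, rfl⟩ := hπ.exists_eq_supportVerts h hconn hB
    exact hsB.2
  have heq : ∀ s, k s = M.tot x s := by
    intro s
    by_cases hs : 0 < M.tot x s
    swap
    · rw [hkx s hs, le_antisymm (not_lt.1 hs) (tot_nonneg h.x_nonneg s)]
    obtain ⟨C, hC, hsC⟩ : s ∈ M.recSet := by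
      by_contra hs'
      exact hs.ne' (h.tot_eq_zero hs')
    have hclosed := hπ.supportVerts_closed h hC
    have hmass := h.mass_eq hπ.1 hQ
      (fun s hs => hπ.y_eq h (by rw [h.tot_eq_zero hs]; exact lt_irrefl 0))
      (fun s _ a _ => by rw [hπ.1.tot_mul z s]) hC
      (D := (Set.toFinite C).toFinset) (fun s => Set.Finite.mem_toFinset _)
    simp only [hπ.1.tot_mul k] at hmass
    have hsub : (Set.toFinite (M.supportVerts x C)).toFinset ⊆ (Set.toFinite C).toFinset :=
      Set.Finite.toFinset_subset_toFinset.2 fun s hs => hs.1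
    have hnot : ∀ s ∈ (Set.toFinite C).toFinset,
        s ∉ (Set.toFinite (M.supportVerts x C)).toFinset → ¬ 0 < M.tot x s := by
      intro s hs hs' hx
      exact hs' ((Set.Finite.mem_toFinset _).2 ⟨(Set.Finite.mem_toFinset _).1 hs, hx⟩)
    refine hP.stationary_unique hst (hπ.stationary h) (V := M.supportVerts x C)
      (fun s hs s' hs' => hP.stationary_no_inflow hk hst hclosed hs hs')
      (fun s hs s' hs' => hP.stationary_no_inflow (tot_nonneg h.x_nonneg) (hπ.stationary h)
        hclosed hs hs') (fun s hs => hs.2) (hπ.stronglyConnectedOn_chainEdge (hconn C hC))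
      (D := (Set.toFinite (M.supportVerts x C)).toFinset)
      (fun s => Set.Finite.mem_toFinset _) ?_ s ⟨hsC, hs⟩
    -- Both vectors vanish on `C` off the support, so equal mass on `C` is equal mass on `V_C⁺(x)`.
    rw [Finset.sum_subset hsub fun s hs hs' => hkx s (hnot s hs hs'),
      Finset.sum_subset hsub fun s hs hs' =>
        le_antisymm (not_lt.1 (hnot s hs hs')) (tot_nonneg h.x_nonneg s)]
    exact hmass.symm
  exact hss.congr_right fun s a ha => by rw [heq, ← hπ.x_eq h s a ha]

end IsPolicyFrom

end MDP

/-! ### Specifications and optimality -/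

theorem LMDP.SpecConstraints.congr {S A : Type*} [Fintype S] {M : LMDP S A} {p q : S → A → ℝ}
    (hp : M.SpecConstraints p) (hpq : ∀ s, ∀ a ∈ M.act s, p s a = q s a) :
    M.SpecConstraints q := by
  intro i
  have h : ∑ s ∈ M.L i, ∑ a ∈ M.act s, q s a = ∑ s ∈ M.L i, ∑ a ∈ M.act s, p s a :=
    Finset.sum_congr rfl fun s _ => Finset.sum_congr rfl fun a ha => (hpq s a ha).symm
  rw [h]
  exact hp i

theorem mainTheorem4 {S A : Type*} [Fintype S] (M : LMDP S A)
    (x y : S → A → ℝ) (hopt : M.OptimalLP3 x y)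
    (hconn : ∀ C : Set S, M.IsTSCCOf C →
      StronglyConnectedOn (M.supportEdge x) (M.supportVerts x C))
    (π : S → A → ℝ) (hπ : M.IsPolicyFrom x y π) :
    π ∈ M.CPU ∧ M.MeetsSpecs π ∧
      ∀ π' ∈ M.CPU, M.MeetsSpecs π' → M.avgReward π' ≤ M.avgReward π := by
  obtain ⟨⟨hQ, hspec⟩, hmax⟩ := hopt
  have hss := hπ.isSteadyState hQ hconn
  refine ⟨hπ.mem_CPU hQ hconn, ⟨x, hss, hspec⟩, ?_⟩
  rintro π' ⟨hπ', hrec, -⟩ ⟨p, hp, hpspec⟩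
  obtain ⟨k, z, -, -, -, hss', hQ'⟩ := hπ'.exists_steadyState hrec
  rw [hss.avgReward_eq, hss'.avgReward_eq]
  -- Uniqueness of limits identifies the given steady state with the `Q₀` point just built, so that
  -- point satisfies the specifications and competes in the LP.
  exact hmax _ _ ⟨hQ', hpspec.congr fun s a ha => tendsto_nhds_unique (hp s a ha) (hss' s a ha)⟩
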